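/- Let $q\in\mathbb C$ with $0<|q|<1$ and let $a_1,\ldots,a_4\in\mathbb C\setminus\{0\}$. Write $a_{ij}:=a_ia_j$ and $a_{1234}:=a_1a_2a_3a_4$, and assume $|q|<|a_{1234}|<1$. Put $(a;q)_n:=\prod_{k=0}^{n-1}(1-aq^k)$, $(a;q)_\infty:=\prod_{k=0}^{\infty}(1-aq^k)$, $\vartheta(x;q):=(x;q)_\infty(q/x;q)_\infty$, where several arguments before the semicolon denote the product of the corresponding functions. Let $${}_6W_5(b;c,d,e;q,z):=\sum_{n=0}^\infty\frac{(q\sqrt b,-q\sqrt b,b,c,d,e;q)_n}{(q,\sqrt b,-\sqrt b,\frac{qb}{c},\frac{qb}{d},\frac{qb}{e};q)_n}\,z^n .$$ For a function $f$ of $(a_1,a_2,a_3,a_4)$ let $\mathcal S\,f(a_1,a_2,a_3,a_4)$ denote the sum of $f(a_1,a_2,a_3,a_4)$ and of the three expressions obtained from it by interchanging $a_1$ with $a_k$ for $k=2,3,4$. Assume that none of the numbers $a_i^{-2}$ $(1\le i\le 4)$, $a_{ij}$ and $a_j/a_i$ $(i\ne j)$ equals $q^m$ for some $m\in\mathbb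 Z$. Then the four ${}_6W_5$ series below converge absolutely, and $$\mathcal S\left[\frac{(a_1^{-2};q)_\infty}{\left(a_{12},a_{13},a_{14},\frac{a_2}{a_1},\frac{a_3}{a_1},\frac{a_4}{a_1};q\right)_\infty}\;{}_6W_5\!\left(a_1^2;a_{12},a_{13},a_{14};q,\frac{q}{a_{1234}}\right)\right]$$ $$=\frac{(a_{1234};q)_\infty}{(a_{12},a_{13},a_{14},a_{23},a_{24},a_{34};q)_\infty}\;\mathcal S\left[\frac{\vartheta(a_1^{-2},a_{23},a_{24},a_{34};q)}{\vartheta\left(a_{1234},\frac{a_2}{a_1},\frac{a_3}{a_1},\frac{a_4}{a_1};q\right)}\right]$$ $$=\frac{2\,(a_{1234};q)_\infty}{(a_{12},a_{13},a_{14},a_{23},a_{24},a_{34};q)_\infty}.$$ -/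

import Mathlib

noncomputable section

/-- The finite `q`-shifted factorial `(a;q)_n = (1-a)(1-aq)⋯(1-aq^(n-1))`. -/
def qPoch (a q : ℂ) (n : ℕ) : ℂ := ∏ k ∈ Finset.range n, (1 - a * q ^ k)

/-- The infinite `q`-shifted factorial `(a;q)_∞ = ∏_{n ≥ 0} (1 - a q^n)`, used for `|q| < 1`. -/
def qPochInf (a q : ℂ) : ℂ := ∏' n : ℕ, (1 - a * q ^ n)

/-- For `|q| < 1` the infinite product converges, so that `qPochInf` has its intended value. -/
theorem multipliable_qPochInf (a : ℂ) {q : ℂ} (hq : ‖q‖ < 1) :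
    Multipliable fun n : ℕ => 1 - a * q ^ n := by
  have h : Summable fun n : ℕ => ‖-(a * q ^ n)‖ := by
    simpa [norm_mul, norm_pow] using
      (summable_geometric_of_lt_one (norm_nonneg q) hq).mul_left ‖a‖
  simpa [sub_eq_add_neg] using multipliable_one_add_of_summable h

/-- `(a_1,…,a_k;q)_n = (a_1;q)_n ⋯ (a_k;q)_n`. -/
def qPochs (as : List ℂ) (q : ℂ) (n : ℕ) : ℂ := (as.map fun a => qPoch a q n).prod

/-- `(a_1,…,a_k;q)_∞ = (a_1;q)_∞ ⋯ (a_k;q)_∞`. -/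
def qPochInfs (as : List ℂ) (q : ℂ) : ℂ := (as.map fun a => qPochInf a q).prod

/-- The modified theta function `ϑ(x;q) = (x, q/x; q)_∞`, for `x ≠ 0`. -/
def modTheta (x q : ℂ) : ℂ := qPochInfs [x, q / x] q

/-- `ϑ(x_1,…,x_k;q) = ϑ(x_1;q) ⋯ ϑ(x_k;q)`. -/
def modThetas (xs : List ℂ) (q : ℂ) : ℂ := (xs.map fun x => modTheta x q).prod

/-- The `k`-th term of the basic hypergeometric series `_{r+1}φ_s(as; bs; q, z)`, where `as` has
`r+1` entries and `bs` has `s` entries. -/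
def qhypTerm (as bs : List ℂ) (q z : ℂ) (k : ℕ) : ℂ :=
  qPochs as q k / qPochs (q :: bs) q k *
    ((-1) ^ k * q ^ k.choose 2) ^ ((bs.length : ℤ) + 1 - (as.length : ℤ)) * z ^ k

/-- The basic hypergeometric series `_{r+1}φ_s(as; bs; q, z)`. -/
def qhyp (as bs : List ℂ) (q z : ℂ) : ℂ := ∑' k : ℕ, qhypTerm as bs q z k

/-- Numerator parameters `±q√b, b, a_4, …, a_{r+1}` of a very-well-poised series. The two square
roots of `b` enter symmetrically, so the choice of the branch is immaterial. -/
def vwpUpper (b : ℂ) (as : List ℂ) (q : ℂ) : List ℂ :=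
  [q * b ^ (1 / 2 : ℂ), -(q * b ^ (1 / 2 : ℂ)), b] ++ as

/-- Denominator parameters `±√b, qb/a_4, …, qb/a_{r+1}` of a very-well-poised series. -/
def vwpLower (b : ℂ) (as : List ℂ) (q : ℂ) : List ℂ :=
  [b ^ (1 / 2 : ℂ), -b ^ (1 / 2 : ℂ)] ++ as.map fun a => q * b / a

/-- The very-well-poised series `_{r+1}W_r(b; a_4, …, a_{r+1}; q, z)`. With three parameters
`a_4, a_5, a_6` in the list this is a `₆W₅`. -/
def vwpW (b : ℂ) (as : List ℂ) (q z : ℂ) : ℂ := qhyp (vwpUpper b as q) (vwpLower b as q) q z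

/-- The symmetric sum `f(a_1,…,a_n) + idem(a_1; a_2,…,a_n)`: the sum of the expressions obtained
from `f` by interchanging `a_1` with `a_k`, for `k = 1, …, n` (no change for `k = 1`). -/
def symSum {n : ℕ} (f : (Fin (n + 1) → ℂ) → ℂ) (a : Fin (n + 1) → ℂ) : ℂ :=
  ∑ k : Fin (n + 1), f (a ∘ Equiv.swap 0 k)

end

open Filter Topology

/-! Each `₆W₅` is summed in closed form by Rogers' nonterminating `₆φ₅` formula (`tsum_vwpTerm`).
Completing the resulting infinite products to theta functions splits off a prefactor symmetric in
the four parameters (`vwpW_eq_modThetas`). This is the first equality, term by term.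

The second equality says that a sum of four theta quotients is 2 (`theta_identity`). Cleared of the
denominators that depend on `x = a₁`, it asserts the vanishing of `thetaNum`, a holomorphic function
on the punctured plane with `f (q x) = q⁻³ x⁻⁴ f x`. Such a function has at most four zeros modulo
powers of `q` unless it is zero (`eq_zero_of_quasiperiodic`), while `b, c, d, b⁻¹, c⁻¹` are five
inequivalent zeros.

Rogers' formula comes from a first-order relation between the series at `u` and at `u q`, where `u`
is the reciprocal of a numerator parameter. The relation is proved by telescoping. Iterating it
moves `u` to `0`, and the constant is fixed by the case `u = 1`, where the series reduces to its
first term. -/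

/-! ### Infinite products and the zeros of the theta function -/

theorem summable_norm_neg_mul_pow (a : ℂ) {q : ℂ} (hq : ‖q‖ < 1) :
    Summable fun n : ℕ => ‖-(a * q ^ n)‖ := by
  simpa [norm_mul, norm_pow] using
    (summable_geometric_of_lt_one (norm_nonneg q) hq).mul_left ‖a‖

theorem qPochInf_ne_zero {a q : ℂ} (hq : ‖q‖ < 1) (h : ∀ n : ℕ, a * q ^ n ≠ 1) :
    qPochInf a q ≠ 0 := by
  have := tprod_one_add_ne_zero_of_summable (f := fun n : ℕ => -(a * q ^ n))
    (fun n => by rw [← sub_eq_add_neg, sub_ne_zero]; exact (h n).symm)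
    (summable_norm_neg_mul_pow a hq)
  simpa [qPochInf, sub_eq_add_neg] using this

theorem tendsto_qPoch (a : ℂ) {q : ℂ} (hq : ‖q‖ < 1) :
    Tendsto (qPoch a q) atTop (𝓝 (qPochInf a q)) :=
  (multipliable_qPochInf a hq).hasProd.tendsto_prod_nat

theorem qPoch_succ (a q : ℂ) (n : ℕ) : qPoch a q (n + 1) = qPoch a q n * (1 - a * q ^ n) :=
  Finset.prod_range_succ _ _

theorem qPoch_zero (a q : ℂ) : qPoch a q 0 = 1 := rfl

theorem qPoch_succ' (a q : ℂ) (n : ℕ) : qPoch a q (n + 1) = (1 - a) * qPoch (a * q) q n := by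
  simp only [qPoch, Finset.prod_range_succ', pow_zero, mul_one]
  rw [mul_comm]
  congr 1
  exact Finset.prod_congr rfl fun k _ => by ring

theorem qPochInf_eq_one_sub_mul (a : ℂ) {q : ℂ} (hq : ‖q‖ < 1) :
    qPochInf a q = (1 - a) * qPochInf (a * q) q := by
  refine tendsto_nhds_unique ((tendsto_qPoch a hq).comp (tendsto_add_atTop_nat 1)) ?_
  simpa only [Function.comp_def, qPoch_succ'] using (tendsto_qPoch (a * q) hq).const_mul (1 - a)

/-- On a compact set of radius `R` the factors differ from 1 by at most `R ‖q‖ ^ n`, so the partial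
products converge locally uniformly. -/
theorem differentiable_qPochInf {q : ℂ} (hq : ‖q‖ < 1) :
    Differentiable ℂ fun a => qPochInf a q := by
  have H : HasProdLocallyUniformlyOn (fun (n : ℕ) (a : ℂ) => 1 - a * q ^ n)
      (fun a => ∏' n : ℕ, (1 - a * q ^ n)) Set.univ := by
    simp_rw [sub_eq_add_neg]
    apply hasProdLocallyUniformlyOn_of_forall_compact isOpen_univ
    intro K _ hcK
    obtain ⟨R, hR⟩ := hcK.isBounded.exists_norm_le
    refine ((summable_geometric_of_lt_one (norm_nonneg _) hq).mul_left
      R).hasProdUniformlyOn_nat_one_add hcK (.of_forall fun n x hx ↦ ?_) (fun _ ↦ by fun_prop)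
    simpa using mul_le_mul_of_nonneg_right (hR x hx) (pow_nonneg (norm_nonneg q) n)
  exact differentiableOn_univ.1 <| H.differentiableOn
    (.of_forall fun _ ↦ by simpa [Finset.prod_fn] using
      DifferentiableOn.finsetProd (fun _ _ ↦ by fun_prop)) isOpen_univ

theorem modTheta_eq (x q : ℂ) : modTheta x q = qPochInf x q * qPochInf (q / x) q := by
  simp [modTheta, qPochInfs]

theorem modTheta_mul_left {q x : ℂ} (hq0 : q ≠ 0) (hq : ‖q‖ < 1) (hx : x ≠ 0) :
    modTheta (q * x) q = -x⁻¹ * modTheta x q := by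
  rw [modTheta_eq, modTheta_eq, qPochInf_eq_one_sub_mul x hq,
    show q / (q * x) = x⁻¹ by field_simp, qPochInf_eq_one_sub_mul x⁻¹ hq,
    show x⁻¹ * q = q / x by ring, mul_comm q x]
  field_simp
  ring

theorem modTheta_inv {q x : ℂ} (hq : ‖q‖ < 1) (hx : x ≠ 0) :
    modTheta x⁻¹ q = -x⁻¹ * modTheta x q := by
  rw [modTheta_eq, modTheta_eq, qPochInf_eq_one_sub_mul x hq,
    show q / x⁻¹ = x * q by field_simp, qPochInf_eq_one_sub_mul x⁻¹ hq,
    show x⁻¹ * q = q / x by ring]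
  field_simp
  ring

theorem modTheta_one {q : ℂ} (hq : ‖q‖ < 1) : modTheta 1 q = 0 := by
  rw [modTheta_eq, qPochInf_eq_one_sub_mul 1 hq]; simp

theorem modTheta_ne_zero {q x : ℂ} (hq0 : q ≠ 0) (hq : ‖q‖ < 1) (h : ∀ m : ℤ, x ≠ q ^ m) :
    modTheta x q ≠ 0 := by
  have hx : x ≠ 0 ∨ x = 0 := (em _).symm
  rw [modTheta_eq]
  refine mul_ne_zero (qPochInf_ne_zero hq fun n hn => h (-n) ?_)
    (qPochInf_ne_zero hq fun n hn => h (n + 1) ?_)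
  · rw [zpow_neg, zpow_natCast]; exact eq_inv_of_mul_eq_one_left hn
  -- The hypothesis admits `x = 0`, where `q / x` takes the default value `0` and all factors are 1.
  · rcases hx with hx | hx
    · rw [zpow_add_one₀ hq0, zpow_natCast]
      field_simp at hn
      rw [← hn]; ring
    · simp [hx] at hn

theorem differentiableAt_modTheta {q x : ℂ} (hq : ‖q‖ < 1) (hx : x ≠ 0) :
    DifferentiableAt ℂ (fun x => modTheta x q) x := by
  simp_rw [modTheta_eq]
  have h1 := differentiable_qPochInf hq
  exact (h1 x).mul (DifferentiableAt.comp x (h1 (q / x))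
    (by fun_prop (disch := assumption) : DifferentiableAt ℂ (fun x => q / x) x))

theorem modTheta_zpow {q : ℂ} (hq0 : q ≠ 0) (hq : ‖q‖ < 1) (m : ℤ) : modTheta (q ^ m) q = 0 := by
  induction m using Int.induction_on with
  | zero => simpa using modTheta_one hq
  | succ n ih =>
    rw [add_comm, zpow_one_add₀ hq0, modTheta_mul_left hq0 hq (zpow_ne_zero _ hq0), ih, mul_zero]
  | pred n ih =>
    have := modTheta_mul_left hq0 hq (zpow_ne_zero (-(n : ℤ) - 1) hq0)
    rw [← zpow_one_add₀ hq0, add_sub_cancel, ih] at this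
    simpa [zpow_ne_zero, hq0] using this.symm

/-- Differentiate the functional equation; at a zero, the term containing the undifferentiated theta
function drops out. -/
theorem deriv_modTheta_mul {q x : ℂ} (hq0 : q ≠ 0) (hq : ‖q‖ < 1) (hx : x ≠ 0)
    (h0 : modTheta x q = 0) :
    q * deriv (fun x => modTheta x q) (q * x) = -x⁻¹ * deriv (fun x => modTheta x q) x := by
  have h1 : HasDerivAt (fun x => modTheta (q * x) q)
      (deriv (fun x => modTheta x q) (q * x) * q) x := by
    have := (differentiableAt_modTheta hq (mul_ne_zero hq0 hx)).hasDerivAt.comp x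
      ((hasDerivAt_id x).const_mul q)
    simpa [Function.comp_def] using this
  have h2 := ((hasDerivAt_inv hx).neg).mul (differentiableAt_modTheta hq hx).hasDerivAt
  have h3 : (fun x => modTheta (q * x) q) =ᶠ[𝓝 x] fun x => -x⁻¹ * modTheta x q := by
    filter_upwards [isOpen_ne.mem_nhds hx] with y hy using modTheta_mul_left hq0 hq hy
  have h4 := h1.unique (h2.congr_of_eventuallyEq h3)
  rw [mul_comm, h4, h0]
  simp

/-- The zeros of theta are simple. At 1 the derivative is `-(q;q)_∞²`, by splitting off the factor
`1 - x`; the differentiated functional equation carries this to every power of `q`, in both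
directions. -/
theorem deriv_modTheta_zpow_ne_zero {q : ℂ} (hq0 : q ≠ 0) (hq : ‖q‖ < 1)
    (m : ℤ) : deriv (fun x => modTheta x q) (q ^ m) ≠ 0 := by
  have key (m : ℤ) := deriv_modTheta_mul hq0 hq (zpow_ne_zero m hq0) (modTheta_zpow hq0 hq m)
  induction m using Int.induction_on with
  | zero =>
    have h1 := differentiable_qPochInf hq
    have hd : DifferentiableAt ℂ (fun x => qPochInf (x * q) q * qPochInf (q / x) q) 1 :=
      (DifferentiableAt.comp 1 (h1 (1 * q)) (by fun_prop : DifferentiableAt ℂ (fun x => x * q) 1)).mul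
      (DifferentiableAt.comp 1 (h1 (q / 1))
        (by fun_prop (disch := simp) : DifferentiableAt ℂ (fun x => q / x) 1))
    have h2 := ((hasDerivAt_id (1 : ℂ)).const_sub 1).mul hd.hasDerivAt
    have h3 : (fun x => modTheta x q) =
        (fun x => 1 - id x) * fun x => qPochInf (x * q) q * qPochInf (q / x) q := by
      ext x
      simp only [modTheta_eq, Pi.mul_apply, id]
      rw [qPochInf_eq_one_sub_mul x hq, mul_assoc]
    have hne : qPochInf q q ≠ 0 := qPochInf_ne_zero hq fun n hn => by
      have : ‖q ^ (n + 1)‖ < 1 := by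
        rw [norm_pow]; exact pow_lt_one₀ (norm_nonneg _) hq (by simp)
      rw [pow_succ', hn] at this
      simp at this
    rw [zpow_zero, h3, h2.deriv]
    simp [hne]
  | succ n ih =>
    intro h
    have := key n
    rw [← zpow_one_add₀ hq0, add_comm, h] at this
    exact ih (by simpa [hq0] using this)
  | pred n ih =>
    intro h
    have := key (-(n : ℤ) - 1)
    rw [← zpow_one_add₀ hq0, add_sub_cancel, h] at this
    exact ih (by simpa [hq0] using this)

/-! ### Quasi-periodic functions on the punctured plane -/

theorem exists_differentiableOn_eq_mul {U : Set ℂ} (hU : IsOpen U) {f g : ℂ → ℂ}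
    (hf : DifferentiableOn ℂ f U) (hg : DifferentiableOn ℂ g U)
    (h : ∀ x ∈ U, g x = 0 → f x = 0 ∧ deriv g x ≠ 0) :
    ∃ k : ℂ → ℂ, DifferentiableOn ℂ k U ∧ ∀ x ∈ U, f x = g x * k x := by
  classical
  refine ⟨fun x => if g x = 0 then deriv f x / deriv g x else f x / g x, fun x hx => ?_,
    fun x hx => ?_⟩
  · apply DifferentiableAt.differentiableWithinAt
    by_cases hgx : g x = 0
    -- Near a common zero both functions are `y - x` times their `dslope`, so the quotient is the
    -- quotient of the slopes, whose denominator does not vanish at `x`.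
    · obtain ⟨hfx, hdg⟩ := h x hx hgx
      have hUx := hU.mem_nhds hx
      have d1 := ((Complex.differentiableOn_dslope hUx).2 hf).differentiableAt hUx
      have d2 := ((Complex.differentiableOn_dslope hUx).2 hg).differentiableAt hUx
      have hne : dslope g x x ≠ 0 := by rwa [dslope_same]
      refine (d1.div d2 hne).congr_of_eventuallyEq ?_
      filter_upwards [d2.continuousAt.eventually_ne hne] with y hy
      rcases eq_or_ne y x with rfl | hyx
      · simp [hgx, dslope_same]
      · have e1 := sub_smul_dslope f x y
        have e2 := sub_smul_dslope g x y
        rw [hfx, sub_zero, smul_eq_mul] at e1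
        rw [hgx, sub_zero, smul_eq_mul] at e2
        have hs : y - x ≠ 0 := sub_ne_zero.2 hyx
        have : g y ≠ 0 := by rw [← e2]; exact mul_ne_zero hs hy
        rw [if_neg this, Pi.div_apply, ← e1, ← e2]
        field_simp
    · have d1 := hf.differentiableAt (hU.mem_nhds hx)
      have d2 := hg.differentiableAt (hU.mem_nhds hx)
      refine (d1.div d2 hgx).congr_of_eventuallyEq ?_
      filter_upwards [d2.continuousAt.eventually_ne hgx] with y hy
      simp [hy]
  · by_cases hgx : g x = 0
    · simp [hgx, (h x hx hgx).1]
    · simp only [hgx, if_false]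
      field_simp

theorem isPreconnected_compl_zero : IsPreconnected ({0}ᶜ : Set ℂ) :=
  (isConnected_compl_singleton_of_one_lt_rank
    (Complex.rank_real_complex ▸ Nat.one_lt_ofNat) 0).isPreconnected

/-- Multiplying a function by `x ^ m` changes its multiplier `c` into `c q ^ m`; this normalises the
multiplier. -/
theorem exists_zpow_norm_mem {q c : ℂ} (hq0 : q ≠ 0) (hq : ‖q‖ < 1) (hc : c ≠ 0) :
    ∃ m : ℤ, ‖q‖ < ‖c * q ^ m‖ ∧ ‖c * q ^ m‖ ≤ 1 := by
  have hq' : 0 < ‖q‖ := norm_pos_iff.2 hq0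
  obtain ⟨n, h1, h2⟩ := exists_mem_Ioc_zpow (norm_pos_iff.2 hc) ((one_lt_inv₀ hq').2 hq)
  rw [inv_zpow, inv_lt_iff_one_lt_mul₀ (zpow_pos hq' _)] at h1
  rw [inv_zpow, le_inv_comm₀ (norm_pos_iff.2 hc) (zpow_pos hq' _),
    le_inv_comm₀ (zpow_pos hq' _) (norm_pos_iff.2 hc)] at h2
  refine ⟨n + 1, ?_, ?_⟩
  · rw [norm_mul, norm_zpow, zpow_add_one₀ hq'.ne', ← mul_assoc]
    rw [mul_comm] at h1
    exact lt_mul_of_one_lt_left hq' (by rwa [mul_comm] at h1)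
  · rw [norm_mul, norm_zpow]
    exact (le_div_iff₀ (zpow_pos hq' _)).1 (by simpa using h2)

/-- Since `‖c‖ ≤ 1`, the bound on a fundamental annulus persists towards 0, so the singularity there
is removable. The entire extension `E` satisfies `E' x = (q / c) ^ n E' (q ^ n x)`, which tends to 0
because `‖q‖ < ‖c‖`. -/
theorem eq_const_of_mul_left_eq {q c : ℂ} (hq0 : q ≠ 0) (hq : ‖q‖ < 1)
    (hc1 : ‖q‖ < ‖c‖) (hc2 : ‖c‖ ≤ 1) {h : ℂ → ℂ} (hd : DifferentiableOn ℂ h {0}ᶜ)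
    (hqh : ∀ x ≠ 0, h (q * x) = c * h x) : ∃ C, ∀ x ≠ 0, h x = C := by
  have hq' : 0 < ‖q‖ := norm_pos_iff.2 hq0
  -- `h` is bounded on the punctured unit disc
  have hbd : ∃ M, ∀ x ≠ 0, ‖x‖ ≤ 1 → ‖h x‖ ≤ M := by
    have hK : IsCompact (Metric.closedBall (0 : ℂ) 1 \ Metric.ball 0 ‖q‖) :=
      (isCompact_closedBall _ _).diff Metric.isOpen_ball
    have hKs : Metric.closedBall (0 : ℂ) 1 \ Metric.ball 0 ‖q‖ ⊆ {0}ᶜ := by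
      rintro x ⟨_, hx⟩ rfl
      exact hx (Metric.mem_ball_self hq')
    obtain ⟨M, hM⟩ := hK.exists_bound_of_continuousOn (hd.continuousOn.mono hKs)
    refine ⟨M, fun x hx hx1 => ?_⟩
    obtain ⟨n, hn1, hn2⟩ := exists_nat_pow_near_of_lt_one (norm_pos_iff.2 hx) hx1 hq' hq
    have hit : ∀ (n : ℕ) (y : ℂ), y ≠ 0 → h (q ^ n * y) = c ^ n * h y := by
      intro n
      induction n with
      | zero => simp
      | succ n ih =>
        intro y hy
        rw [pow_succ', mul_assoc, hqh _ (mul_ne_zero (pow_ne_zero _ hq0) hy), ih y hy]; ring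
    have hy : x / q ^ n ≠ 0 := div_ne_zero hx (pow_ne_zero _ hq0)
    have hxe : x = q ^ n * (x / q ^ n) := by field_simp
    rw [hxe, hit _ _ hy, norm_mul, norm_pow]
    refine (mul_le_of_le_one_left (norm_nonneg _) (pow_le_one₀ (norm_nonneg _) hc2)).trans
      (hM _ ⟨?_, ?_⟩)
    · rw [mem_closedBall_zero_iff, norm_div, norm_pow]
      exact div_le_one_of_le₀ hn2 (by positivity)
    · rw [mem_ball_zero_iff, norm_div, norm_pow, not_lt, le_div_iff₀ (by positivity), ← pow_succ']
      exact hn1.le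
  obtain ⟨M, hM⟩ := hbd
  set E := Function.update h 0 (limUnder (𝓝[≠] 0) h) with hE
  have hEh : ∀ x ≠ 0, E x = h x := fun x hx => Function.update_of_ne hx _ _
  have hEd : Differentiable ℂ E := by
    intro x
    rcases eq_or_ne x 0 with rfl | hx
    · have hB : Metric.ball (0 : ℂ) 1 ∈ 𝓝 0 := Metric.ball_mem_nhds _ one_pos
      refine (Complex.differentiableOn_update_limUnder_of_bddAbove hB
        (hd.mono fun x hx => hx.2) ⟨M, ?_⟩).differentiableAt hB
      rintro _ ⟨x, ⟨hx1, hx2⟩, rfl⟩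
      exact hM x hx2 (mem_ball_zero_iff.1 hx1).le
    · refine (hd.differentiableAt (isOpen_ne.mem_nhds hx)).congr_of_eventuallyEq ?_
      filter_upwards [isOpen_ne.mem_nhds hx] with y hy using hEh y hy
  have hEq : ∀ x, E (q * x) = c * E x := by
    have : (fun x => E (q * x)) = fun x => c * E x := by
      refine Continuous.ext_on (dense_compl_singleton (0 : ℂ)) ?_ ?_ fun x hx => ?_
      · exact hEd.continuous.comp (by fun_prop)
      · exact continuous_const.mul hEd.continuous
      · rw [hEh _ (mul_ne_zero hq0 hx), hEh x hx, hqh x hx]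
    exact congrFun this
  have hc0 : c ≠ 0 := by rintro rfl; simp at hc1; linarith [norm_nonneg q]
  have hdE : ∀ x, deriv E x = (q / c) * deriv E (q * x) := by
    intro x
    have h1 : HasDerivAt (fun x => E (q * x)) (deriv E (q * x) * q) x := by
      simpa [Function.comp_def] using
        (hEd (q * x)).hasDerivAt.comp x ((hasDerivAt_id x).const_mul q)
    have h2 : HasDerivAt (fun x => E (q * x)) (c * deriv E x) x := by
      simp_rw [hEq]; exact (hEd x).hasDerivAt.const_mul c
    have := h1.unique h2
    field_simp
    linear_combination -this
  have hzero : ∀ x, deriv E x = 0 := by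
    intro x
    have hit : ∀ n : ℕ, deriv E x = (q / c) ^ n * deriv E (q ^ n * x) := by
      intro n
      induction n with
      | zero => simp
      | succ n ih => rw [ih, hdE (q ^ n * x)]; ring_nf
    have hlim : Tendsto (fun n : ℕ => (q / c) ^ n * deriv E (q ^ n * x)) atTop
        (𝓝 (0 * deriv E (0 * x))) := by
      refine (tendsto_pow_atTop_nhds_zero_of_norm_lt_one ?_).mul
        (((hEd.contDiff (n := 1)).continuous_deriv le_rfl).continuousAt.tendsto.comp
        ((tendsto_pow_atTop_nhds_zero_of_norm_lt_one hq).mul_const x))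
      rw [norm_div]
      exact (div_lt_one (hq'.trans hc1)).2 hc1
    rw [zero_mul] at hlim
    refine tendsto_nhds_unique ?_ hlim
    simp_rw [← hit]
    exact tendsto_const_nhds
  exact ⟨E 0, fun x hx => by rw [← hEh x hx]; exact is_const_of_deriv_eq_zero hEd hzero x 0⟩

theorem eq_zero_of_mul_left_eq {q c : ℂ} (hq0 : q ≠ 0) (hq : ‖q‖ < 1) (hc : c ≠ 0)
    {h : ℂ → ℂ} (hd : DifferentiableOn ℂ h {0}ᶜ)
    (hqh : ∀ x ≠ 0, h (q * x) = c * h x) {y : ℂ} (hy : y ≠ 0) (hy0 : h y = 0) :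
    ∀ x ≠ 0, h x = 0 := by
  obtain ⟨m, h1, h2⟩ := exists_zpow_norm_mem hq0 hq hc
  obtain ⟨C, hC⟩ := eq_const_of_mul_left_eq hq0 hq h1 h2 (h := fun x => x ^ m * h x)
    ((differentiableOn_id.zpow (Or.inl fun x hx => hx)).mul hd) (fun x hx => by
      rw [hqh x hx, mul_zpow]; ring)
  have hC0 : C = 0 := by simpa [hy0] using (hC y hy).symm
  intro x hx
  have := hC x hx
  rw [hC0] at this
  exact (mul_eq_zero.1 this).resolve_left (zpow_ne_zero _ hx)

/-- A holomorphic function on the punctured plane with `f (q x) = c x⁻ᵈ f x` vanishes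
identically as soon as it has `d + 1` zeros that are inequivalent modulo powers of `q`. -/
theorem eq_zero_of_quasiperiodic {q : ℂ} (hq0 : q ≠ 0) (hq : ‖q‖ < 1) (d : ℕ) :
    ∀ {c : ℂ} (_ : c ≠ 0) {f : ℂ → ℂ} (_ : DifferentiableOn ℂ f {0}ᶜ)
    (_ : ∀ x ≠ 0, f (q * x) = c * (x ^ d)⁻¹ * f x) (y : Fin (d + 1) → ℂ) (_ : ∀ i, y i ≠ 0)
    (_ : ∀ i j, i ≠ j → ∀ m : ℤ, y i / y j ≠ q ^ m) (_ : ∀ i, f (y i) = 0),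
    ∀ x ≠ 0, f x = 0 := by
  induction d with
  | zero =>
    intro c hc f hd hqf y hy _ hfy
    exact eq_zero_of_mul_left_eq hq0 hq hc hd (by simpa using hqf) (hy 0) (hfy 0)
  | succ d ih =>
    intro c hc f hd hqf y hy hyq hfy
    set z := y 0 with hz
    have hz0 : z ≠ 0 := hy 0
    have hfz : ∀ m : ℤ, f (z * q ^ m) = 0 := by
      intro m
      have hne : ∀ m : ℤ, z * q ^ m ≠ 0 := fun m => mul_ne_zero hz0 (zpow_ne_zero _ hq0)
      induction m using Int.induction_on with
      | zero => simpa using hfy 0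
      | succ n ihn =>
        rw [zpow_add_one₀ hq0, ← mul_assoc, mul_comm, hqf _ (hne _), ihn, mul_zero]
      | pred n ihn =>
        have := hqf _ (hne (-(n : ℤ) - 1))
        rw [mul_left_comm, ← zpow_one_add₀ hq0, add_sub_cancel, ihn, eq_comm] at this
        exact (mul_eq_zero.1 this).resolve_left
          (mul_ne_zero hc (inv_ne_zero (pow_ne_zero _ (hne _))))
    have hgat : ∀ x ≠ 0, HasDerivAt (fun x => modTheta (x / z) q)
        (deriv (fun x => modTheta x q) (x / z) * (1 / z)) x := fun x hx =>
      HasDerivAt.comp (h₂ := fun x => modTheta x q) (h := fun x => x / z) x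
        (differentiableAt_modTheta hq (div_ne_zero hx hz0)).hasDerivAt
        ((hasDerivAt_id x).div_const z)
    have hgd : DifferentiableOn ℂ (fun x => modTheta (x / z) q) {0}ᶜ := fun x hx =>
      (hgat x hx).differentiableAt.differentiableWithinAt
    -- Divide by a theta function whose simple zeros are exactly the `q`-orbit of `z`. The quotient
    -- `k` has degree one less and keeps the remaining zeros.
    obtain ⟨k, hkd, hk⟩ := exists_differentiableOn_eq_mul isOpen_compl_singleton hd hgd (by
      intro x hx hx0
      obtain ⟨m, hm⟩ : ∃ m : ℤ, x / z = q ^ m := by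
        by_contra! hcon
        exact modTheta_ne_zero hq0 hq hcon hx0
      refine ⟨?_, ?_⟩
      · rw [show x = z * q ^ m by rw [← hm]; field_simp]; exact hfz m
      · rw [(hgat x hx).deriv, hm]
        exact mul_ne_zero (deriv_modTheta_zpow_ne_zero hq0 hq m) (one_div_ne_zero hz0))
    have hkq : ∀ x ≠ 0, k (q * x) = (-c / z) * (x ^ d)⁻¹ * k x := by
      have hdiff1 : DifferentiableOn ℂ (fun x => k (q * x)) {0}ᶜ :=
        hkd.comp (by fun_prop) fun x hx => mul_ne_zero hq0 hx
      have hdiff2 : DifferentiableOn ℂ (fun x => (-c / z) * (x ^ d)⁻¹ * k x) {0}ᶜ :=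
        (((differentiableOn_id.pow d).inv fun x hx => pow_ne_zero _ hx).const_mul _).mul hkd
      -- Cancelling theta is legitimate only off its zeros; the identity theorem gives the relation
      -- everywhere, as theta does not vanish identically.
      have hor := AnalyticOnNhd.eq_zero_or_eq_zero_of_mul_eq_zero
        (hgd.analyticOnNhd isOpen_compl_singleton)
        ((hdiff1.sub hdiff2).analyticOnNhd isOpen_compl_singleton) (fun x hx => by
          have e := hqf x hx
          rw [hk x hx, hk _ (mul_ne_zero hq0 hx), mul_div_assoc,
            modTheta_mul_left hq0 hq (div_ne_zero hx hz0)] at e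
          have hx' : x ≠ 0 := hx
          simp only [Pi.sub_apply]
          field_simp at e ⊢
          refine mul_left_cancel₀ hx' ?_
          rw [pow_succ] at e
          linear_combination -e) isPreconnected_compl_zero
      rcases hor with h0 | h0
      · exfalso
        have h1 := deriv_modTheta_zpow_ne_zero hq0 hq 0
        have h2 := (hgat z hz0).deriv
        rw [div_self hz0] at h2
        have h3 : (fun x => modTheta (x / z) q) =ᶠ[𝓝 z] fun _ => 0 := by
          filter_upwards [isOpen_ne.mem_nhds hz0] with x hx using h0 x hx
        rw [h3.deriv_eq, deriv_const] at h2
        simp at h1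
        simp [h1, hz0] at h2
      · intro x hx
        exact sub_eq_zero.1 (h0 x hx)
    have := ih (div_ne_zero (neg_ne_zero.2 hc) hz0) hkd hkq (fun i => y i.succ) (fun i => hy _)
      (fun i j hij => hyq _ _ (by simpa using hij)) (fun i => by
        have := hk _ (hy i.succ)
        rw [hfy, eq_comm] at this
        exact (mul_eq_zero.1 this).resolve_left
          (modTheta_ne_zero hq0 hq (hyq _ _ (Fin.succ_ne_zero i))))
    intro x hx
    rw [hk x hx, this x hx, mul_zero]

/-! ### The theta function identity -/

/-- The numerator of the theta function identity, as a function of one of the four variables. -/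
noncomputable def thetaNum (q b c d x : ℂ) : ℂ :=
  modTheta (x ^ 2)⁻¹ q * modTheta (b * c) q * modTheta (b * d) q * modTheta (c * d) q
  - (b / x) * (modTheta (b ^ 2)⁻¹ q * modTheta (x * c) q * modTheta (x * d) q * modTheta (c * d) q *
      modTheta (c / x) q * modTheta (d / x) q / (modTheta (c / b) q * modTheta (d / b) q))
  - (c / x) * (modTheta (c ^ 2)⁻¹ q * modTheta (x * b) q * modTheta (x * d) q * modTheta (b * d) q *
      modTheta (b / x) q * modTheta (d / x) q / (modTheta (b / c) q * modTheta (d / c) q))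
  - (d / x) * (modTheta (d ^ 2)⁻¹ q * modTheta (x * b) q * modTheta (x * c) q * modTheta (b * c) q *
      modTheta (b / x) q * modTheta (c / x) q / (modTheta (b / d) q * modTheta (c / d) q))
  - 2 * (modTheta (x * b * c * d) q * modTheta (b / x) q * modTheta (c / x) q * modTheta (d / x) q)

theorem thetaNum_swap₁ (q b c d x : ℂ) : thetaNum q c b d x = thetaNum q b c d x := by
  simp only [thetaNum]
  rw [mul_comm c b, mul_right_comm x c b]
  ring

theorem thetaNum_swap₂ (q b c d x : ℂ) : thetaNum q b d c x = thetaNum q b c d x := by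
  simp only [thetaNum]
  rw [mul_comm d c, mul_right_comm (x * b) d c]
  ring

theorem differentiableOn_thetaNum {q b c d : ℂ} (hq : ‖q‖ < 1) (hb : b ≠ 0)
    (hc : c ≠ 0) (hd : d ≠ 0) : DifferentiableOn ℂ (thetaNum q b c d) {0}ᶜ := by
  intro x hx
  have hx : x ≠ 0 := hx
  apply DifferentiableAt.differentiableWithinAt
  have key (g : ℂ → ℂ) (hg : DifferentiableAt ℂ g x) (h0 : g x ≠ 0) :
      DifferentiableAt ℂ (fun x => modTheta (g x) q) x :=
    DifferentiableAt.comp (g := fun x => modTheta x q) x (differentiableAt_modTheta hq h0) hg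
  have h1 := key (fun x => (x ^ 2)⁻¹) (by fun_prop (disch := simpa)) (by simpa)
  have hm (e : ℂ) (he : e ≠ 0) := key (fun x => x * e) (by fun_prop) (mul_ne_zero hx he)
  have hv (e : ℂ) (he : e ≠ 0) := key (fun x => e / x) (by fun_prop (disch := simpa))
    (div_ne_zero he hx)
  have h4 := key (fun x => x * b * c * d) (by fun_prop) (by simp [*])
  have dv (e : ℂ) : DifferentiableAt ℂ (fun x => e / x) x := by fun_prop (disch := simpa)
  have b1 := hm b hb
  have c1 := hm c hc
  have d1 := hm d hd
  have b2 := hv b hb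
  have c2 := hv c hc
  have d2 := hv d hd
  exact (((((h1.mul_const _).mul_const _).mul_const _).sub
    ((dv b).mul (((((((c1.const_mul _).mul d1).mul_const _).mul c2).mul d2).div_const _)))).sub
    ((dv c).mul (((((((b1.const_mul _).mul d1).mul_const _).mul b2).mul d2).div_const _)))).sub
    ((dv d).mul (((((((b1.const_mul _).mul c1).mul_const _).mul b2).mul c2).div_const _))) |>.sub
    ((((h4.mul b2).mul c2).mul d2).const_mul _)

theorem thetaNum_mul_left {q b c d x : ℂ} (hq0 : q ≠ 0) (hq : ‖q‖ < 1) (hb : b ≠ 0)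
    (hc : c ≠ 0) (hd : d ≠ 0) (hx : x ≠ 0) :
    thetaNum q b c d (q * x) = (q ^ 3)⁻¹ * (x ^ 4)⁻¹ * thetaNum q b c d x := by
  have hm (e : ℂ) (he : e ≠ 0) : modTheta (q * x * e) q = -(x * e)⁻¹ * modTheta (x * e) q := by
    rw [mul_assoc, modTheta_mul_left hq0 hq (mul_ne_zero hx he)]
  have hv (e : ℂ) (he : e ≠ 0) : modTheta (e / (q * x)) q =
      -(e / (q * x)) * modTheta (e / x) q := by
    have := modTheta_mul_left (x := e / (q * x)) hq0 hq (by simp [*])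
    rw [show q * (e / (q * x)) = e / x by field_simp] at this
    rw [this]
    field_simp
  have h2 : modTheta ((q * x) ^ 2)⁻¹ q = (q ^ 3)⁻¹ * (x ^ 4)⁻¹ * modTheta (x ^ 2)⁻¹ q := by
    have e1 := modTheta_mul_left (x := ((q * x) ^ 2)⁻¹) hq0 hq (by simp [*])
    have e2 := modTheta_mul_left (x := q * ((q * x) ^ 2)⁻¹) hq0 hq (by simp [*])
    rw [show q * (q * ((q * x) ^ 2)⁻¹) = (x ^ 2)⁻¹ by field_simp, e1] at e2
    rw [e2]
    field_simp
  have h4 : modTheta (q * x * b * c * d) q =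
      -(x * b * c * d)⁻¹ * modTheta (x * b * c * d) q := by
    rw [show q * x * b * c * d = q * x * (b * c * d) by ring, hm _ (by simp [*]), ← mul_assoc,
      ← mul_assoc]
  simp only [thetaNum]
  rw [h2, hm b hb, hm c hc, hm d hd, hv b hb, hv c hc, hv d hd, h4]
  simp only [div_eq_mul_inv, mul_inv]
  field_simp

/-- At `x = b` the last three products contain `ϑ(1) = 0`, and the first two cancel. -/
theorem thetaNum_self {q b c d : ℂ} (hq : ‖q‖ < 1) (hb : b ≠ 0)
    (h1 : modTheta (c / b) q ≠ 0) (h2 : modTheta (d / b) q ≠ 0) :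
    thetaNum q b c d b = 0 := by
  simp only [thetaNum, div_self hb, modTheta_one hq]
  field_simp
  ring

/-- At `x = b⁻¹` the terms of `c` and `d` contain `ϑ(1) = 0`. The first two terms become equal after
inverting `b ^ 2`, and together they match the last one: this is where the constant 2 comes from. -/
theorem thetaNum_inv {q b c d : ℂ} (hq : ‖q‖ < 1) (hb : b ≠ 0)
    (h1 : modTheta (c / b) q ≠ 0) (h2 : modTheta (d / b) q ≠ 0) :
    thetaNum q b c d b⁻¹ = 0 := by
  have e := modTheta_inv (x := b ^ 2) hq (by simpa)
  simp only [thetaNum, inv_mul_cancel₀ hb, modTheta_one hq, e, div_inv_eq_mul, one_mul,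
    inv_pow, inv_inv, mul_comm b⁻¹, ← div_eq_mul_inv, mul_comm c b, mul_comm d b, ← pow_two]
  field_simp
  ring

theorem thetaNum_eq_zero {q b c d x : ℂ} (hq0 : q ≠ 0) (hq : ‖q‖ < 1) (hb : b ≠ 0)
    (hc : c ≠ 0) (hd : d ≠ 0) (hx : x ≠ 0)
    (hb2 : ∀ m : ℤ, (b ^ 2)⁻¹ ≠ q ^ m) (hc2 : ∀ m : ℤ, (c ^ 2)⁻¹ ≠ q ^ m)
    (hbc : ∀ m : ℤ, b * c ≠ q ^ m) (hbd : ∀ m : ℤ, b * d ≠ q ^ m) (hcd : ∀ m : ℤ, c * d ≠ q ^ m)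
    (hcb' : ∀ m : ℤ, c / b ≠ q ^ m) (hdb' : ∀ m : ℤ, d / b ≠ q ^ m)
    (hdc' : ∀ m : ℤ, d / c ≠ q ^ m) : thetaNum q b c d x = 0 := by
  have hinv {z : ℂ} (h : ∀ m : ℤ, z ≠ q ^ m) (m : ℤ) : z⁻¹ ≠ q ^ m := fun hm => h (-m) (by
    rw [zpow_neg, ← hm, inv_inv])
  have hdi {y z : ℂ} (h : ∀ m : ℤ, y / z ≠ q ^ m) (m : ℤ) : z / y ≠ q ^ m := by
    rw [← inv_div]; exact hinv h m
  have nz {z : ℂ} (h : ∀ m : ℤ, z ≠ q ^ m) : modTheta z q ≠ 0 := modTheta_ne_zero hq0 hq h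
  refine eq_zero_of_quasiperiodic hq0 hq 4 (inv_ne_zero (pow_ne_zero 3 hq0))
    (differentiableOn_thetaNum hq hb hc hd)
    (fun x hx => thetaNum_mul_left hq0 hq hb hc hd hx) ![b, c, d, b⁻¹, c⁻¹] ?_ ?_ ?_ x hx
  · simp [Fin.forall_fin_succ, *]
  · have hb2' := hinv hb2
    have hc2' := hinv hc2
    have hsymm : ∀ y : Fin 5 → ℂ, (∀ i j, i < j → ∀ m : ℤ, y i / y j ≠ q ^ m) →
        ∀ i j, i ≠ j → ∀ m : ℤ, y i / y j ≠ q ^ m := by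
      intro y h i j hij
      rcases lt_or_gt_of_ne hij with hlt | hlt
      · exact h i j hlt
      · exact hdi (h j i hlt)
    apply hsymm
    have hcb := hdi hcb'
    have hdb := hdi hdb'
    have hdc := hdi hdc'
    simp only [inv_inv, pow_two] at hb2' hc2'
    have hc' : ∀ m : ℤ, b⁻¹ / c⁻¹ ≠ q ^ m := by
      simpa [div_eq_mul_inv, mul_comm] using hcb'
    simp [Fin.forall_fin_succ, div_inv_eq_mul, mul_comm d, mul_comm c b, hbc, hbd, hcd, hcb, hdb, hdc,
      hb2', hc2', ← div_eq_inv_mul, hcb']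
  · have z1 := nz hcb'
    have z2 := nz hdb'
    have z3 := nz hdc'
    have z4 := nz (hdi hcb')
    have z5 := nz (hdi hdb')
    have z6 := nz (hdi hdc')
    have s1 := thetaNum_swap₁ q b c d
    have s2 := thetaNum_swap₂ q b c d
    have s3 : ∀ x, thetaNum q d b c x = thetaNum q b c d x := fun x => by
      rw [thetaNum_swap₁, s2]
    simp only [Fin.forall_fin_succ]
    refine ⟨thetaNum_self hq hb z1 z2, (s1 _).symm.trans (thetaNum_self hq hc z4 z3),
      (s3 _).symm.trans (thetaNum_self hq hd z5 z6), thetaNum_inv hq hb z1 z2,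
      (s1 _).symm.trans (thetaNum_inv hq hc z4 z3), fun i => i.elim0⟩

theorem theta_identity {q a b c d : ℂ} (hq0 : q ≠ 0) (hq : ‖q‖ < 1) (ha : a ≠ 0) (hb : b ≠ 0)
    (hc : c ≠ 0) (hd : d ≠ 0)
    (hb2 : ∀ m : ℤ, (b ^ 2)⁻¹ ≠ q ^ m) (hc2 : ∀ m : ℤ, (c ^ 2)⁻¹ ≠ q ^ m)
    (hbc : ∀ m : ℤ, b * c ≠ q ^ m) (hbd : ∀ m : ℤ, b * d ≠ q ^ m) (hcd : ∀ m : ℤ, c * d ≠ q ^ m)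
    (hba' : ∀ m : ℤ, b / a ≠ q ^ m) (hca' : ∀ m : ℤ, c / a ≠ q ^ m) (hda' : ∀ m : ℤ, d / a ≠ q ^ m)
    (hcb' : ∀ m : ℤ, c / b ≠ q ^ m) (hdb' : ∀ m : ℤ, d / b ≠ q ^ m)
    (hdc' : ∀ m : ℤ, d / c ≠ q ^ m) (habcd : ∀ m : ℤ, a * b * c * d ≠ q ^ m) :
    modThetas [(a ^ 2)⁻¹, b * c, b * d, c * d] q /
        modThetas [a * b * c * d, b / a, c / a, d / a] q
      + modThetas [(b ^ 2)⁻¹, a * c, a * d, c * d] q /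
        modThetas [a * b * c * d, a / b, c / b, d / b] q
      + modThetas [(c ^ 2)⁻¹, a * b, a * d, b * d] q /
        modThetas [a * b * c * d, a / c, b / c, d / c] q
      + modThetas [(d ^ 2)⁻¹, a * b, a * c, b * c] q /
        modThetas [a * b * c * d, a / d, b / d, c / d] q = 2 := by
  have h := thetaNum_eq_zero hq0 hq hb hc hd ha hb2 hc2 hbc hbd hcd hcb' hdb' hdc'
  have nz {z : ℂ} (h : ∀ m : ℤ, z ≠ q ^ m) : modTheta z q ≠ 0 := modTheta_ne_zero hq0 hq h
  have hdi {y z : ℂ} (h : ∀ m : ℤ, y / z ≠ q ^ m) (m : ℤ) : z / y ≠ q ^ m := fun hm => h (-m) (by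
    rw [zpow_neg, ← hm, inv_div])
  have z1 := nz hcb'
  have z2 := nz hdb'
  have z3 := nz hdc'
  have z4 := nz (hdi hcb')
  have z5 := nz (hdi hdb')
  have z6 := nz (hdi hdc')
  have z7 := nz hba'
  have z8 := nz hca'
  have z9 := nz hda'
  have z0 := nz habcd
  -- Inverting the arguments `a / y` produces a common denominator and the weights `-(y / a)` of
  -- `thetaNum`.
  have fl {y z : ℂ} (hy : y ≠ 0) (hz : z ≠ 0) :
      modTheta (y / z) q = -(y / z) * modTheta (z / y) q := by
    rw [← inv_div z y, modTheta_inv hq (div_ne_zero hz hy)]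
  simp only [modThetas, List.map_cons, List.map_nil, List.prod_cons, List.prod_nil, mul_one]
  rw [fl ha hb, fl ha hc, fl ha hd]
  simp only [thetaNum] at h
  generalize modTheta (a * b * c * d) q = t0 at *
  generalize modTheta (b / a) q = t1 at *
  generalize modTheta (c / a) q = t2 at *
  generalize modTheta (d / a) q = t3 at *
  have : ∀ X Y Z W : ℂ, X - (b / a) * Y - c / a * Z - d / a * W - 2 * (t0 * t1 * t2 * t3) = 0 →
      (X - (b / a) * Y - c / a * Z - d / a * W) / (t0 * t1 * t2 * t3) = 2 := by
    intro X Y Z W h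
    rw [div_eq_iff (by simp [*])]
    linear_combination h
  have := this _ _ _ _ h
  rw [← this]
  simp only [sub_div]
  have hf : ∀ y : ℂ, y ≠ 0 → (-(a / y))⁻¹ = - (y / a) := fun y hy => by
    rw [inv_neg, inv_div]
  field_simp
  ring

/-! ### Rogers' `₆φ₅` summation -/

/-- The product `(x - 1)(x - q)⋯(x - q^(n-1))`. -/
noncomputable def powSubProd (x q : ℂ) (n : ℕ) : ℂ := ∏ k ∈ Finset.range n, (x - q ^ k)

theorem powSubProd_succ (x q : ℂ) (n : ℕ) :
    powSubProd x q (n + 1) = powSubProd x q n * (x - q ^ n) := Finset.prod_range_succ _ _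

theorem powSubProd_mul_succ (x q : ℂ) (n : ℕ) :
    powSubProd (x * q) q (n + 1) = q ^ n * (x * q - 1) * powSubProd x q n := by
  induction n with
  | zero => simp [powSubProd]
  | succ n ih => rw [powSubProd_succ, ih, powSubProd_succ]; ring

theorem qPoch_add (a q : ℂ) (m n : ℕ) :
    qPoch a q (m + n) = qPoch a q m * qPoch (a * q ^ m) q n := by
  simp only [qPoch, Finset.prod_range_add]
  congr 1
  exact Finset.prod_congr rfl fun k _ => by ring

theorem qPoch_ne_zero {a q : ℂ} (h : ∀ n : ℕ, a * q ^ n ≠ 1) (n : ℕ) : qPoch a q n ≠ 0 :=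
  Finset.prod_ne_zero_iff.2 fun k _ => sub_ne_zero.2 (h k).symm

theorem exists_norm_qPoch_le (a : ℂ) {q : ℂ} (hq : ‖q‖ < 1) :
    ∃ M > 0, ∀ n, ‖qPoch a q n‖ ≤ M := by
  obtain ⟨M, hM⟩ := (Metric.isBounded_range_of_tendsto _ (tendsto_qPoch a hq)).exists_pos_norm_le
  exact ⟨M, hM.1, fun n => hM.2 _ ⟨n, rfl⟩⟩

/-- Uniformity in the shift `N` follows from `1 / (a q^N;q)_n = (a;q)_N / (a;q)_{N+n}`; it is needed
for dominated convergence. -/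
theorem exists_norm_inv_qPoch_le {a q : ℂ} (hq : ‖q‖ < 1) (h : ∀ n : ℕ, a * q ^ n ≠ 1) :
    ∃ M > 0, ∀ N n, ‖(qPoch (a * q ^ N) q n)⁻¹‖ ≤ M := by
  obtain ⟨M, hM0, hM⟩ := exists_norm_qPoch_le a hq
  obtain ⟨M', hM0', hM'⟩ := (Metric.isBounded_range_of_tendsto _
    ((tendsto_qPoch a hq).inv₀ (qPochInf_ne_zero hq h))).exists_pos_norm_le
  refine ⟨M * M', by positivity, fun N n => ?_⟩
  have e : (qPoch (a * q ^ N) q n)⁻¹ = qPoch a q N * (qPoch a q (N + n))⁻¹ := by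
    rw [qPoch_add, mul_inv, mul_inv_cancel_left₀ (qPoch_ne_zero h N)]
  rw [e, norm_mul]
  exact mul_le_mul (hM N) (hM' _ ⟨_, rfl⟩) (norm_nonneg _) hM0.le

theorem norm_powSubProd_le {x q : ℂ} {r : ℝ} (hx : ‖x‖ ≤ r) (n : ℕ) :
    ‖powSubProd x q n‖ ≤ ∏ k ∈ Finset.range n, (r + ‖q‖ ^ k) := by
  rw [powSubProd, norm_prod]
  refine Finset.prod_le_prod (fun _ _ => norm_nonneg _) fun k _ => (norm_sub_le _ _).trans ?_
  rw [norm_pow]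
  gcongr

/-- The terms of the very-well-poised `₆φ₅` series in terms of the reciprocals `u, v, w` of its
three free numerator parameters. -/
noncomputable def vwpTerm (b q u v w : ℂ) (n : ℕ) : ℂ :=
  (1 - b * q ^ (2 * n)) / (1 - b) * (qPoch b q n / qPoch q q n) *
    (powSubProd u q n / qPoch (b * q * u) q n) * (powSubProd v q n / qPoch (b * q * v) q n) *
    (powSubProd w q n / qPoch (b * q * w) q n) * (b * q) ^ n

/-- Up to a constant, a majorant of the terms at `u q^N` for all `N` at once; its successive ratios
tend to `‖b q u v w‖`. -/
noncomputable def vwpBound (b q u v w : ℂ) (n : ℕ) : ℝ :=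
  (∏ k ∈ Finset.range n, (‖u‖ + ‖q‖ ^ k)) * (∏ k ∈ Finset.range n, (‖v‖ + ‖q‖ ^ k)) *
    (∏ k ∈ Finset.range n, (‖w‖ + ‖q‖ ^ k)) * ‖b * q‖ ^ n

theorem vwpBound_pos {b q : ℂ} (hb : b ≠ 0) (hq0 : q ≠ 0) (u v w : ℂ) (n : ℕ) :
    0 < vwpBound b q u v w n := by
  have := norm_pos_iff.2 hq0
  have := norm_pos_iff.2 (mul_ne_zero hb hq0)
  have hp (z : ℂ) : 0 < ∏ k ∈ Finset.range n, (‖z‖ + ‖q‖ ^ k) :=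
    Finset.prod_pos fun _ _ => by positivity
  have := hp u
  have := hp v
  have := hp w
  unfold vwpBound
  positivity

theorem summable_vwpBound {b q u v w : ℂ} (hb : b ≠ 0) (hq0 : q ≠ 0) (hq : ‖q‖ < 1)
    (h : ‖b * q * u * v * w‖ < 1) : Summable (vwpBound b q u v w) := by
  refine summable_of_ratio_test_tendsto_lt_one h
    (.of_forall fun n => (vwpBound_pos hb hq0 u v w n).ne') ?_
  have e : ∀ n, ‖vwpBound b q u v w (n + 1)‖ / ‖vwpBound b q u v w n‖ =
      (‖u‖ + ‖q‖ ^ n) * (‖v‖ + ‖q‖ ^ n) * (‖w‖ + ‖q‖ ^ n) * ‖b * q‖ := fun n => by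
    have h0 := vwpBound_pos hb hq0 u v w n
    rw [Real.norm_of_nonneg (vwpBound_pos hb hq0 u v w (n + 1)).le, Real.norm_of_nonneg h0.le,
      div_eq_iff h0.ne']
    simp only [vwpBound, Finset.prod_range_succ]
    ring
  simp_rw [e]
  have hp := tendsto_pow_atTop_nhds_zero_of_lt_one (norm_nonneg q) hq
  convert (((hp.const_add ‖u‖).mul (hp.const_add ‖v‖)).mul (hp.const_add ‖w‖)).mul_const
    ‖b * q‖ using 2
  simp only [norm_mul, add_zero]
  ring

theorem norm_one_sub_mul_pow_le (b : ℂ) {q : ℂ} (hq : ‖q‖ < 1) (n : ℕ) :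
    ‖1 - b * q ^ n‖ ≤ 1 + ‖b‖ := by
  refine (norm_sub_le _ _).trans ?_
  rw [norm_one, norm_mul, norm_pow]
  gcongr
  exact mul_le_of_le_one_right (norm_nonneg _) (pow_le_one₀ (norm_nonneg _) hq.le)

theorem self_mul_pow_ne_one {q : ℂ} (hq : ‖q‖ < 1) (n : ℕ) : q * q ^ n ≠ 1 := fun hn => by
  have : ‖q ^ (n + 1)‖ < 1 := by
    rw [norm_pow]; exact pow_lt_one₀ (norm_nonneg _) hq (by simp)
  rw [pow_succ', hn] at this
  simp at this

section

variable {b q u v w : ℂ}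

theorem exists_norm_vwpTerm_le (hq : ‖q‖ < 1)
    (hu : ∀ n : ℕ, b * q * u * q ^ n ≠ 1) (hv : ∀ n : ℕ, b * q * v * q ^ n ≠ 1)
    (hw : ∀ n : ℕ, b * q * w * q ^ n ≠ 1) :
    ∃ C, ∀ N n, ‖vwpTerm b q (u * q ^ N) v w n‖ ≤ C * vwpBound b q u v w n := by
  obtain ⟨M1, p1, h1⟩ := exists_norm_qPoch_le b hq
  obtain ⟨M2, p2, h2⟩ := exists_norm_inv_qPoch_le hq (self_mul_pow_ne_one hq)
  obtain ⟨M3, p3, h3⟩ := exists_norm_inv_qPoch_le hq hu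
  obtain ⟨M4, p4, h4⟩ := exists_norm_inv_qPoch_le hq hv
  obtain ⟨M5, p5, h5⟩ := exists_norm_inv_qPoch_le hq hw
  refine ⟨(1 + ‖b‖) * ‖(1 - b)⁻¹‖ * (M1 * M2) * M3 * M4 * M5, fun N n => ?_⟩
  have hN : ‖u * q ^ N‖ ≤ ‖u‖ := by
    rw [norm_mul, norm_pow]
    exact mul_le_of_le_one_right (norm_nonneg _) (pow_le_one₀ (norm_nonneg _) hq.le)
  have k2 := h2 0 n
  have k3 := h3 N n
  have k4 := h4 0 n
  have k5 := h5 0 n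
  simp only [pow_zero, mul_one] at k2 k4 k5
  have : vwpTerm b q (u * q ^ N) v w n = (1 - b * q ^ (2 * n)) * (1 - b)⁻¹ *
      (qPoch b q n * (qPoch q q n)⁻¹) * (qPoch (b * q * u * q ^ N) q n)⁻¹ *
      (qPoch (b * q * v) q n)⁻¹ * (qPoch (b * q * w) q n)⁻¹ *
      (powSubProd (u * q ^ N) q n * powSubProd v q n * powSubProd w q n * (b * q) ^ n) := by
    rw [vwpTerm, ← mul_assoc (b * q) u]
    ring
  rw [this, vwpBound]
  simp only [norm_mul _ (_ * _ ^ _ : ℂ), norm_mul]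
  rw [norm_pow, norm_mul]
  have a1 := norm_powSubProd_le (q := q) hN n
  have a2 := norm_powSubProd_le (q := q) (le_refl ‖v‖) n
  have a3 := norm_powSubProd_le (q := q) (le_refl ‖w‖) n
  have a0 := norm_one_sub_mul_pow_le b hq (2 * n)
  have a4 := h1 n
  have q1 : 0 ≤ ∏ k ∈ Finset.range n, (‖u‖ + ‖q‖ ^ k) := Finset.prod_nonneg fun _ _ => by positivity
  have q2 : 0 ≤ ∏ k ∈ Finset.range n, (‖v‖ + ‖q‖ ^ k) := Finset.prod_nonneg fun _ _ => by positivity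
  have q3 : 0 ≤ ∏ k ∈ Finset.range n, (‖w‖ + ‖q‖ ^ k) := Finset.prod_nonneg fun _ _ => by positivity
  gcongr

theorem summable_vwpTerm (hb : b ≠ 0) (hq0 : q ≠ 0) (hq : ‖q‖ < 1)
    (hu : ∀ n : ℕ, b * q * u * q ^ n ≠ 1) (hv : ∀ n : ℕ, b * q * v * q ^ n ≠ 1)
    (hw : ∀ n : ℕ, b * q * w * q ^ n ≠ 1) (h : ‖b * q * u * v * w‖ < 1) :
    Summable (vwpTerm b q u v w) := by
  obtain ⟨C, hC⟩ := exists_norm_vwpTerm_le hq hu hv hw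
  exact .of_norm_bounded ((summable_vwpBound hb hq0 hq h).mul_left C) fun n => by
    simpa using hC 0 n

/-- The telescoping certificate for the `q`-shift of the parameter `u`. -/
noncomputable def vwpCert (b q u v w : ℂ) (n : ℕ) : ℂ :=
  -u * (qPoch (b * q) q n / qPoch q q n) * (powSubProd v q (n + 1) / qPoch (b * q * v) q n) *
    (powSubProd w q (n + 1) / qPoch (b * q * w) q n) * (b * q) ^ (n + 1) *
    (powSubProd u q n / qPoch (b * q * u * q) q n)

theorem sum_vwpTerm_sub (hb1 : b ≠ 1) (hq : ‖q‖ < 1)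
    (hu : ∀ n : ℕ, b * q * u * q ^ n ≠ 1) (hv : ∀ n : ℕ, b * q * v * q ^ n ≠ 1)
    (hw : ∀ n : ℕ, b * q * w * q ^ n ≠ 1) (N : ℕ) :
    ∑ n ∈ Finset.range (N + 1),
      ((1 - b * q * u) * (1 - b * q * u * v * w) * vwpTerm b q u v w n -
        (1 - b * q * u * v) * (1 - b * q * u * w) * vwpTerm b q (u * q) v w n) =
      vwpCert b q u v w N := by
  have hb1' : 1 - b ≠ 0 := sub_ne_zero.2 hb1.symm
  induction N with
  | zero =>
    simp [vwpTerm, vwpCert, powSubProd, qPoch, hb1']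
    ring
  | succ N ih =>
    rw [Finset.sum_range_succ, ih]
    have hu' : ∀ n : ℕ, b * q * u * q * q ^ n ≠ 1 := fun n => by
      simpa [pow_succ', mul_assoc] using hu (n + 1)
    have n1 := qPoch_ne_zero (self_mul_pow_ne_one hq) N
    have n2 := qPoch_ne_zero hu' N
    have n3 := qPoch_ne_zero hv N
    have n4 := qPoch_ne_zero hw N
    have m1 : 1 - q * q ^ N ≠ 0 := sub_ne_zero.2 (self_mul_pow_ne_one hq N).symm
    have m2 : 1 - b * q * u * q * q ^ N ≠ 0 := sub_ne_zero.2 (hu' N).symm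
    have m3 : 1 - b * q * v * q ^ N ≠ 0 := sub_ne_zero.2 (hv N).symm
    have m4 : 1 - b * q * w * q ^ N ≠ 0 := sub_ne_zero.2 (hw N).symm
    have m5 : 1 - b * q * u ≠ 0 := sub_ne_zero.2 (by simpa using (hu 0).symm)
    have e1 : qPoch b q (N + 1) = (1 - b) * qPoch (b * q) q N := qPoch_succ' _ _ _
    have e2 : qPoch (b * q * u) q (N + 1) = (1 - b * q * u) * qPoch (b * q * u * q) q N :=
      qPoch_succ' _ _ _
    have e3 : q ^ (2 * (N + 1)) = q ^ 2 * (q ^ N) ^ 2 := by ring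
    have e4 : q ^ (N + 1) = q * q ^ N := pow_succ' _ _
    simp only [vwpTerm, vwpCert]
    rw [← mul_assoc (b * q) u q, e1, e2, e3, powSubProd_mul_succ, powSubProd_succ u,
      powSubProd_succ v q (N + 1), powSubProd_succ w q (N + 1), qPoch_succ q,
      qPoch_succ (b * q * v), qPoch_succ (b * q * w), qPoch_succ (b * q * u * q),
      qPoch_succ (b * q) q N, e4, pow_succ (b * q) (N + 1)]
    generalize q ^ N = X at *
    generalize (b * q) ^ (N + 1) = Y at *
    generalize qPoch (b * q) q N = Y1 at *
    generalize qPoch q q N = Y2 at *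
    generalize qPoch (b * q * u * q) q N = Y3 at *
    generalize qPoch (b * q * v) q N = Y4 at *
    generalize qPoch (b * q * w) q N = Y5 at *
    generalize powSubProd v q (N + 1) = Y6 at *
    generalize powSubProd w q (N + 1) = Y7 at *
    generalize powSubProd u q N = Y8 at *
    clear e1 e2 e3 e4 ih hu hv hw hu'
    generalize d0 : 1 - b = D0 at *
    generalize d1 : 1 - q * X = D1 at *
    generalize d2 : 1 - b * q * u * q * X = D2 at *
    generalize d3 : 1 - b * q * v * X = D3 at *
    generalize d4 : 1 - b * q * w * X = D4 at *
    generalize d5 : 1 - b * q * u = D5 at *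
    -- With the common factor `K` taken out, the induction step is a rational identity in `X = q ^
    -- N`.
    have key : ∀ K : ℂ, -u * K + (D5 * (1 - b * q * u * v * w) *
        ((1 - b * (q ^ 2 * X ^ 2)) * K * ((u - X) / (D1 * D3 * D4 * D5))) -
        (1 - b * q * u * v) * (1 - b * q * u * w) *
        ((1 - b * (q ^ 2 * X ^ 2)) * K * (X * (u * q - 1) / (D1 * D3 * D4 * D2)))) =
        -u * K * ((1 - b * q * X) * (v - q * X) * (w - q * X) * (b * q) * (u - X) /
          (D1 * D3 * D4 * D2)) := by
      intro K
      field_simp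
      rw [← d1, ← d2, ← d3, ← d4]
      ring
    refine Eq.trans ?_ ((key (Y1 / Y2 * (Y6 / Y4) * (Y7 / Y5) * Y * (Y8 / Y3))).trans ?_)
    · congr 1
      · ring
      · congr 1
        · congr 1
          field_simp
        · congr 1
          field_simp
    · clear key d0 d1 d2 d3 d4 d5
      generalize v - q * X = Z1
      generalize w - q * X = Z2
      generalize 1 - b * q * X = Z3
      generalize u - X = Z4
      ring

theorem tendsto_vwpCert (hb : b ≠ 0) (hq0 : q ≠ 0) (hq : ‖q‖ < 1)
    (hu : ∀ n : ℕ, b * q * u * q ^ n ≠ 1) (hv : ∀ n : ℕ, b * q * v * q ^ n ≠ 1)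
    (hw : ∀ n : ℕ, b * q * w * q ^ n ≠ 1) (h : ‖b * q * u * v * w‖ < 1) :
    Tendsto (vwpCert b q u v w) atTop (𝓝 0) := by
  obtain ⟨M1, p1, h1⟩ := exists_norm_qPoch_le (b * q) hq
  obtain ⟨M2, p2, h2⟩ := exists_norm_inv_qPoch_le hq (self_mul_pow_ne_one hq)
  obtain ⟨M3, p3, h3⟩ := exists_norm_inv_qPoch_le hq hu
  obtain ⟨M4, p4, h4⟩ := exists_norm_inv_qPoch_le hq hv
  obtain ⟨M5, p5, h5⟩ := exists_norm_inv_qPoch_le hq hw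
  refine squeeze_zero_norm (a := fun n => ‖u‖ * (M1 * M2) * M3 * M4 * M5 *
    ((‖v‖ + 1) * (‖w‖ + 1) * ‖b * q‖) * vwpBound b q u v w n) (fun n => ?_) ?_
  · have k2 := h2 0 n
    have k3 := h3 1 n
    have k4 := h4 0 n
    have k5 := h5 0 n
    simp only [pow_zero, mul_one, pow_one] at k2 k3 k4 k5
    have : vwpCert b q u v w n = -(u * (qPoch (b * q) q n * (qPoch q q n)⁻¹) *
        (qPoch (b * q * u * q) q n)⁻¹ * (qPoch (b * q * v) q n)⁻¹ * (qPoch (b * q * w) q n)⁻¹ *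
        ((v - q ^ n) * (w - q ^ n) * (b * q)) *
        (powSubProd u q n * powSubProd v q n * powSubProd w q n * (b * q) ^ n)) := by
      rw [vwpCert, powSubProd_succ, powSubProd_succ]
      ring
    rw [this, vwpBound, norm_neg]
    have hx (x : ℂ) : ‖x - q ^ n‖ ≤ ‖x‖ + 1 := by
      refine (norm_sub_le _ _).trans ?_
      rw [norm_pow]
      gcongr
      exact pow_le_one₀ (norm_nonneg _) hq.le
    have a1 := norm_powSubProd_le (q := q) (le_refl ‖u‖) n
    have a2 := norm_powSubProd_le (q := q) (le_refl ‖v‖) n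
    have a3 := norm_powSubProd_le (q := q) (le_refl ‖w‖) n
    have a4 := h1 n
    have a5 := hx v
    have a6 := hx w
    have q1 : 0 ≤ ∏ k ∈ Finset.range n, (‖u‖ + ‖q‖ ^ k) :=
      Finset.prod_nonneg fun _ _ => by positivity
    have q2 : 0 ≤ ∏ k ∈ Finset.range n, (‖v‖ + ‖q‖ ^ k) :=
      Finset.prod_nonneg fun _ _ => by positivity
    have q3 : 0 ≤ ∏ k ∈ Finset.range n, (‖w‖ + ‖q‖ ^ k) :=
      Finset.prod_nonneg fun _ _ => by positivity
    simp only [norm_mul, norm_pow]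
    gcongr
  · simpa using (summable_vwpBound hb hq0 hq h).tendsto_atTop_zero.const_mul
      (‖u‖ * (M1 * M2) * M3 * M4 * M5 * ((‖v‖ + 1) * (‖w‖ + 1) * ‖b * q‖))

theorem mul_pow_shift_ne_one (hu : ∀ n : ℕ, b * q * u * q ^ n ≠ 1) (N n : ℕ) :
    b * q * (u * q ^ N) * q ^ n ≠ 1 := by
  simpa [pow_add, mul_assoc] using hu (N + n)

theorem norm_shift_lt_one (hq : ‖q‖ < 1) (h : ‖b * q * u * v * w‖ < 1) (N : ℕ) :
    ‖b * q * (u * q ^ N) * v * w‖ < 1 := by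
  rw [show b * q * (u * q ^ N) * v * w = b * q * u * v * w * q ^ N by ring, norm_mul, norm_pow]
  exact (mul_le_of_le_one_right (norm_nonneg _) (pow_le_one₀ (norm_nonneg _) hq.le)).trans_lt h

theorem tsum_vwpTerm_shift (hb : b ≠ 0) (hb1 : b ≠ 1) (hq0 : q ≠ 0) (hq : ‖q‖ < 1)
    (hu : ∀ n : ℕ, b * q * u * q ^ n ≠ 1) (hv : ∀ n : ℕ, b * q * v * q ^ n ≠ 1)
    (hw : ∀ n : ℕ, b * q * w * q ^ n ≠ 1) (h : ‖b * q * u * v * w‖ < 1) :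
    (1 - b * q * u) * (1 - b * q * u * v * w) * ∑' n, vwpTerm b q u v w n =
      (1 - b * q * u * v) * (1 - b * q * u * w) * ∑' n, vwpTerm b q (u * q) v w n := by
  have s1 := (summable_vwpTerm hb hq0 hq hu hv hw h).hasSum.mul_left
    ((1 - b * q * u) * (1 - b * q * u * v * w))
  have s2 := (summable_vwpTerm (u := u * q) hb hq0 hq
    (by simpa using mul_pow_shift_ne_one hu 1) hv hw
    (by simpa using norm_shift_lt_one hq h 1)).hasSum.mul_left
    ((1 - b * q * u * v) * (1 - b * q * u * w))
  have t := (s1.sub s2).tendsto_sum_nat.comp (tendsto_add_atTop_nat 1)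
  simp only [Function.comp_def, sum_vwpTerm_sub hb1 hq hu hv hw] at t
  exact sub_eq_zero.1 (tendsto_nhds_unique t (tendsto_vwpCert hb hq0 hq hu hv hw h))

theorem qPoch_mul_tsum_vwpTerm (hb : b ≠ 0) (hb1 : b ≠ 1) (hq0 : q ≠ 0) (hq : ‖q‖ < 1)
    (hu : ∀ n : ℕ, b * q * u * q ^ n ≠ 1) (hv : ∀ n : ℕ, b * q * v * q ^ n ≠ 1)
    (hw : ∀ n : ℕ, b * q * w * q ^ n ≠ 1) (h : ‖b * q * u * v * w‖ < 1) (N : ℕ) :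
    qPoch (b * q * u) q N * qPoch (b * q * u * v * w) q N * ∑' n, vwpTerm b q u v w n =
      qPoch (b * q * u * v) q N * qPoch (b * q * u * w) q N *
        ∑' n, vwpTerm b q (u * q ^ N) v w n := by
  induction N with
  | zero => simp [qPoch_zero]
  | succ N ih =>
    have := tsum_vwpTerm_shift (u := u * q ^ N) hb hb1 hq0 hq (mul_pow_shift_ne_one hu N) hv hw
      (norm_shift_lt_one hq h N)
    simp only [qPoch_succ]
    rw [mul_assoc u, ← pow_succ] at this
    linear_combination (1 - b * q * u * q ^ N) * (1 - b * q * u * v * w * q ^ N) * ih +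
      qPoch (b * q * u * v) q N * qPoch (b * q * u * w) q N * this

theorem tendsto_vwpTerm_shift (b u v w : ℂ) (hq : ‖q‖ < 1) (n : ℕ) :
    Tendsto (fun N : ℕ => vwpTerm b q (u * q ^ N) v w n) atTop (𝓝 (vwpTerm b q 0 v w n)) := by
  have h0 : Tendsto (fun N : ℕ => u * q ^ N) atTop (𝓝 0) := by
    simpa using (tendsto_pow_atTop_nhds_zero_of_norm_lt_one hq).const_mul u
  have hc : ContinuousAt (fun x => vwpTerm b q x v w n) 0 := by
    simp only [vwpTerm, powSubProd, qPoch]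
    have : ∏ k ∈ Finset.range n, (1 - b * q * 0 * q ^ k) ≠ 0 := by simp
    fun_prop (disch := assumption)
  exact hc.tendsto.comp h0

/-- Let `N → ∞` in the iterated shift relation. Working with reciprocals turns the limit of an
infinite numerator parameter into evaluation at `u = 0`. -/
theorem qPochInf_mul_tsum_vwpTerm (hb : b ≠ 0) (hb1 : b ≠ 1) (hq0 : q ≠ 0) (hq : ‖q‖ < 1)
    (hu : ∀ n : ℕ, b * q * u * q ^ n ≠ 1) (hv : ∀ n : ℕ, b * q * v * q ^ n ≠ 1)
    (hw : ∀ n : ℕ, b * q * w * q ^ n ≠ 1) (h : ‖b * q * u * v * w‖ < 1) :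
    qPochInf (b * q * u) q * qPochInf (b * q * u * v * w) q * ∑' n, vwpTerm b q u v w n =
      qPochInf (b * q * u * v) q * qPochInf (b * q * u * w) q * ∑' n, vwpTerm b q 0 v w n := by
  obtain ⟨C, hC⟩ := exists_norm_vwpTerm_le hq hu hv hw
  have t := tendsto_tsum_of_dominated_convergence ((summable_vwpBound hb hq0 hq h).mul_left C)
    (tendsto_vwpTerm_shift b u v w hq) (.of_forall hC)
  refine tendsto_nhds_unique (((tendsto_qPoch _ hq).mul (tendsto_qPoch _ hq)).mul_const _) ?_
  simp_rw [qPoch_mul_tsum_vwpTerm hb hb1 hq0 hq hu hv hw h]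
  exact ((tendsto_qPoch _ hq).mul (tendsto_qPoch _ hq)).mul t

theorem vwpTerm_swap (b q u v w : ℂ) : vwpTerm b q u v w = vwpTerm b q v u w := by
  ext n
  simp only [vwpTerm]
  ring

theorem qPochInf_zero (q : ℂ) : qPochInf 0 q = 1 := by simp [qPochInf]

theorem tsum_vwpTerm_one (b q u w : ℂ) (hb1 : b ≠ 1) : ∑' n, vwpTerm b q 1 u w n = 1 := by
  rw [tsum_eq_single 0]
  · simp [vwpTerm, powSubProd, qPoch, sub_ne_zero.2 hb1.symm]
  · intro n hn
    have : powSubProd 1 q n = 0 :=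
      Finset.prod_eq_zero (Finset.mem_range.2 (Nat.pos_of_ne_zero hn)) (by simp)
    simp [vwpTerm, this]

/-- Rogers' nonterminating very-well-poised `₆φ₅` summation. -/
theorem tsum_vwpTerm (hb : b ≠ 0) (hb1 : ∀ n : ℕ, b * q ^ n ≠ 1) (hq0 : q ≠ 0) (hq : ‖q‖ < 1)
    (hu : ∀ n : ℕ, b * q * u * q ^ n ≠ 1) (hv : ∀ n : ℕ, b * q * v * q ^ n ≠ 1)
    (hw : ∀ n : ℕ, b * q * w * q ^ n ≠ 1) (h : ‖b * q * u * v * w‖ < 1) :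
    qPochInf (b * q * u) q * qPochInf (b * q * v) q * qPochInf (b * q * w) q *
        qPochInf (b * q * u * v * w) q * ∑' n, vwpTerm b q u v w n =
      qPochInf (b * q) q * qPochInf (b * q * u * v) q * qPochInf (b * q * u * w) q *
        qPochInf (b * q * v * w) q := by
  have hb1' : b ≠ 1 := by simpa using hb1 0
  have h0 : ∀ n : ℕ, b * q * 0 * q ^ n ≠ 1 := by simp
  have h1 : ∀ n : ℕ, b * q * 1 * q ^ n ≠ 1 := fun n => by
    simpa [pow_succ', mul_assoc] using hb1 (n + 1)
  -- `A` sends `u` to 0 and `B` then sends `v` to 0. `C` evaluates the remaining series by starting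
  -- from `u = 1`, where the sum is 1.
  have A := qPochInf_mul_tsum_vwpTerm hb hb1' hq0 hq hu hv hw h
  have B := qPochInf_mul_tsum_vwpTerm hb hb1' hq0 hq hv h0 hw (by simp)
  have C := qPochInf_mul_tsum_vwpTerm hb hb1' hq0 hq h1 h0 hw (by simp)
  rw [tsum_vwpTerm_one b q 0 w hb1'] at C
  rw [vwpTerm_swap b q v 0 w] at B
  simp only [mul_zero, zero_mul, qPochInf_zero, mul_one, one_mul] at B C
  linear_combination qPochInf (b * q * v) q * qPochInf (b * q * w) q * A +
    qPochInf (b * q * u * v) q * qPochInf (b * q * u * w) q * qPochInf (b * q * w) q * B -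
    qPochInf (b * q * u * v) q * qPochInf (b * q * u * w) q * qPochInf (b * q * v * w) q * C

end

/-! ### From `₆W₅` to theta quotients -/

theorem qPoch_eq_pow_mul_powSubProd {c : ℂ} (hc : c ≠ 0) (q : ℂ) (n : ℕ) :
    qPoch c q n = c ^ n * powSubProd c⁻¹ q n := by
  rw [qPoch, powSubProd, ← Finset.card_range n, ← Finset.prod_const, Finset.card_range,
    ← Finset.prod_mul_distrib]
  exact Finset.prod_congr rfl fun k _ => by field_simp

theorem qPoch_mul_one_sub (s q : ℂ) (n : ℕ) :
    (1 - s) * qPoch (q * s) q n = qPoch s q n * (1 - s * q ^ n) := by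
  rw [← qPoch_succ, qPoch_succ', mul_comm s q]

/-- The factors with `±√b` collapse to `(1 - b q^(2n)) / (1 - b)`, and the powers of `c`, `d`, `e`
released by passing to reciprocals are absorbed by the argument. -/
theorem qhypTerm_vwp_eq {b c d e q : ℂ} (hc : c ≠ 0) (hd : d ≠ 0) (he : e ≠ 0)
    (hb1 : ∀ n : ℕ, b * q ^ n ≠ 1) (n : ℕ) :
    qhypTerm (vwpUpper b [c, d, e] q) (vwpLower b [c, d, e] q) q (b * q / (c * d * e)) n =
      vwpTerm b q c⁻¹ d⁻¹ e⁻¹ n := by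
  obtain ⟨s, hs, hsb⟩ : ∃ s : ℂ, b ^ (1 / 2 : ℂ) = s ∧ b = s ^ 2 := by
    refine ⟨_, rfl, ?_⟩
    rw [← Complex.cpow_nat_mul]
    simp
  have hne (n : ℕ) : (1 - s * q ^ n) * (1 + s * q ^ n) ≠ 0 := by
    have := hb1 (2 * n)
    intro h
    apply this
    rw [hsb]
    linear_combination -h
  have p1 : qPoch s q n ≠ 0 := qPoch_ne_zero (fun k hk => hne k (by rw [hk]; ring)) n
  have p2 : qPoch (-s) q n ≠ 0 := qPoch_ne_zero (fun k hk => hne k (by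
    rw [show 1 + s * q ^ k = 1 - -s * q ^ k by ring, hk]; ring)) n
  have p0 : 1 - b ≠ 0 := sub_ne_zero.2 (by simpa using (hb1 0).symm)
  have q1 := qPoch_mul_one_sub s q n
  have q2 := qPoch_mul_one_sub (-s) q n
  have key : qPoch (q * s) q n * qPoch (-(q * s)) q n / (qPoch s q n * qPoch (-s) q n) =
      (1 - b * q ^ (2 * n)) / (1 - b) := by
    rw [div_eq_div_iff (mul_ne_zero p1 p2) p0, hsb, ← mul_neg]
    linear_combination (1 + s) * qPoch (q * -s) q n * q1 + qPoch s q n * (1 - s * q ^ n) * q2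
  simp only [qhypTerm, vwpUpper, vwpLower, hs, qPochs, List.map_cons, List.map_nil,
    List.prod_cons, List.prod_nil, List.cons_append, List.nil_append, List.length_cons,
    List.length_nil, mul_one]
  rw [vwpTerm, ← key, qPoch_eq_pow_mul_powSubProd hc, qPoch_eq_pow_mul_powSubProd hd,
    qPoch_eq_pow_mul_powSubProd he, mul_comm q b]
  simp only [← div_eq_mul_inv]
  have hz : (b * q) ^ n = c ^ n * d ^ n * e ^ n * (b * q / (c * d * e)) ^ n := by
    rw [← mul_pow, ← mul_pow, ← mul_pow, mul_div_cancel₀ _ (by simp [*])]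
  rw [hz]
  -- Six upper and five lower parameters give the sign and `q`-power factor the exponent 0.
  norm_num only [zpow_zero]
  generalize (b * q / (c * d * e)) ^ n = Z
  ring

/-- The general term of the theta function form of the nonterminating `₆φ₅` summation. -/
theorem vwpW_eq_modThetas {q a b c d : ℂ} (hq0 : q ≠ 0) (hq1 : ‖q‖ < 1)
    (ha : a ≠ 0) (hb : b ≠ 0) (hc : c ≠ 0) (hd : d ≠ 0)
    (hsq : ∀ m : ℤ, (a ^ 2)⁻¹ ≠ q ^ m)
    (hab : ∀ m : ℤ, a * b ≠ q ^ m) (hac : ∀ m : ℤ, a * c ≠ q ^ m) (had : ∀ m : ℤ, a * d ≠ q ^ m)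
    (hbc : ∀ m : ℤ, b * c ≠ q ^ m) (hbd : ∀ m : ℤ, b * d ≠ q ^ m) (hcd : ∀ m : ℤ, c * d ≠ q ^ m)
    (hba : ∀ m : ℤ, b / a ≠ q ^ m) (hca : ∀ m : ℤ, c / a ≠ q ^ m) (hda : ∀ m : ℤ, d / a ≠ q ^ m)
    (hlow : ‖q‖ < ‖a * b * c * d‖) (habcd : ∀ m : ℤ, a * b * c * d ≠ q ^ m) :
    Summable (qhypTerm (vwpUpper (a ^ 2) [a * b, a * c, a * d] q)
        (vwpLower (a ^ 2) [a * b, a * c, a * d] q) q (q / (a * b * c * d))) ∧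
    qPochInf ((a ^ 2)⁻¹) q / qPochInfs [a * b, a * c, a * d, b / a, c / a, d / a] q *
        vwpW (a ^ 2) [a * b, a * c, a * d] q (q / (a * b * c * d)) =
      qPochInf (a * b * c * d) q /
          qPochInfs [a * b, a * c, a * d, b * c, b * d, c * d] q *
        (modThetas [(a ^ 2)⁻¹, b * c, b * d, c * d] q /
          modThetas [a * b * c * d, b / a, c / a, d / a] q) := by
  have shift {z : ℂ} (h : ∀ m : ℤ, z ≠ q ^ m) (n : ℕ) : z * q ^ n ≠ 1 := fun hn => h (-n) (by
    rw [zpow_neg, zpow_natCast]; exact eq_inv_of_mul_eq_one_left hn)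
  have inv {z : ℂ} (h : ∀ m : ℤ, z ≠ q ^ m) (m : ℤ) : z⁻¹ ≠ q ^ m := fun hm => h (-m) (by
    rw [zpow_neg, ← hm, inv_inv])
  have shift' {z : ℂ} (h : ∀ m : ℤ, z ≠ q ^ m) (n : ℕ) : q / z * q ^ n ≠ 1 := by
    simpa [div_eq_mul_inv, pow_succ', mul_comm, mul_left_comm, mul_assoc] using shift (inv h) (n + 1)
  have hb0 : a ^ 2 ≠ 0 := pow_ne_zero 2 ha
  have hb1 : ∀ n : ℕ, a ^ 2 * q ^ n ≠ 1 := by simpa using shift (inv hsq)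
  -- With `b = a ^ 2`, every product in Rogers' formula has the form `(q / z;q)_∞`, the half of
  -- `ϑ(z;q)` that the prefactors lack.
  have r (y : ℂ) (hy : y ≠ 0) : a ^ 2 * q * (a * y)⁻¹ = q / (y / a) := by field_simp
  have r4 : a ^ 2 * q * (a * b)⁻¹ * (a * c)⁻¹ * (a * d)⁻¹ = q / (a * b * c * d) := by field_simp
  have r2 (y z : ℂ) (hy : y ≠ 0) (hz : z ≠ 0) :
      a ^ 2 * q * (a * y)⁻¹ * (a * z)⁻¹ = q / (y * z) := by field_simp
  have hu : ∀ n : ℕ, a ^ 2 * q * (a * b)⁻¹ * q ^ n ≠ 1 := by rw [r b hb]; exact shift' hba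
  have hv : ∀ n : ℕ, a ^ 2 * q * (a * c)⁻¹ * q ^ n ≠ 1 := by rw [r c hc]; exact shift' hca
  have hw : ∀ n : ℕ, a ^ 2 * q * (a * d)⁻¹ * q ^ n ≠ 1 := by rw [r d hd]; exact shift' hda
  have hn : ‖a ^ 2 * q * (a * b)⁻¹ * (a * c)⁻¹ * (a * d)⁻¹‖ < 1 := by
    rw [r4, norm_div]
    exact (div_lt_one ((norm_nonneg q).trans_lt hlow)).2 hlow
  have hz : q / (a * b * c * d) = a ^ 2 * q / (a * b * (a * c) * (a * d)) := by field_simp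
  have hT : qhypTerm (vwpUpper (a ^ 2) [a * b, a * c, a * d] q)
      (vwpLower (a ^ 2) [a * b, a * c, a * d] q) q (q / (a * b * c * d)) =
      vwpTerm (a ^ 2) q (a * b)⁻¹ (a * c)⁻¹ (a * d)⁻¹ := by
    ext n
    rw [hz, qhypTerm_vwp_eq (mul_ne_zero ha hb) (mul_ne_zero ha hc) (mul_ne_zero ha hd) hb1]
  rw [vwpW, qhyp, hT]
  refine ⟨summable_vwpTerm hb0 hq0 hq1 hu hv hw hn, ?_⟩
  have S := tsum_vwpTerm hb0 hb1 hq0 hq1 hu hv hw hn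
  rw [r4, r2 b c hb hc, r2 b d hb hd, r2 c d hc hd, r b hb, r c hc, r d hd] at S
  have nz {z : ℂ} (h : ∀ m : ℤ, z ≠ q ^ m) : qPochInf z q ≠ 0 := qPochInf_ne_zero hq1 (shift h)
  have nz' {z : ℂ} (h : ∀ m : ℤ, z ≠ q ^ m) : qPochInf (q / z) q ≠ 0 :=
    qPochInf_ne_zero hq1 (shift' h)
  have := nz hab
  have := nz hac
  have := nz had
  have := nz hbc
  have := nz hbd
  have := nz hcd
  have := nz hba
  have := nz hca
  have := nz hda
  have := nz habcd
  have := nz' hba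
  have := nz' hca
  have := nz' hda
  have := nz' habcd
  rw [mul_comm, ← eq_div_iff (by simp only [ne_eq, mul_eq_zero, not_or]; tauto)] at S
  rw [S]
  simp only [modThetas, qPochInfs, modTheta_eq, List.map_cons, List.map_nil, List.prod_cons,
    List.prod_nil, mul_one]
  rw [show q / (a ^ 2)⁻¹ = a ^ 2 * q by field_simp]
  generalize qPochInf (q / (b / a)) q = y1 at *
  generalize qPochInf (q / (c / a)) q = y2 at *
  generalize qPochInf (q / (d / a)) q = y3 at *
  generalize qPochInf (q / (a * b * c * d)) q = y4 at *
  generalize qPochInf (b / a) q = x1 at *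
  generalize qPochInf (c / a) q = x2 at *
  generalize qPochInf (d / a) q = x3 at *
  generalize qPochInf (q / (b * c)) q = z1
  generalize qPochInf (q / (b * d)) q = z2
  generalize qPochInf (q / (c * d)) q = z3
  field_simp

/-! ### Symmetrisation -/

theorem symSum_fin_four (f : (Fin 4 → ℂ) → ℂ) (a : Fin 4 → ℂ) :
    symSum f a = f (a ∘ Equiv.swap 0 0) + f (a ∘ Equiv.swap 0 1) + f (a ∘ Equiv.swap 0 2) +
      f (a ∘ Equiv.swap 0 3) := Fin.sum_univ_four _

theorem mainTheorem9 (q : ℂ) (hq0 : q ≠ 0) (hq1 : ‖q‖ < 1)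
    (a : Fin 4 → ℂ) (ha : ∀ i, a i ≠ 0)
    (hsq : ∀ i, ∀ m : ℤ, (a i ^ 2)⁻¹ ≠ q ^ m)
    (hprod : ∀ i j, i ≠ j → ∀ m : ℤ, a i * a j ≠ q ^ m)
    (hquot : ∀ i j, i ≠ j → ∀ m : ℤ, a j / a i ≠ q ^ m)
    (hlow : ‖q‖ < ‖a 0 * a 1 * a 2 * a 3‖) (hup : ‖a 0 * a 1 * a 2 * a 3‖ < 1) :
    (∀ k : Fin 4, ∀ c : Fin 4 → ℂ, c = a ∘ Equiv.swap 0 k →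
      Summable (qhypTerm
        (vwpUpper (c 0 ^ 2) [c 0 * c 1, c 0 * c 2, c 0 * c 3] q)
        (vwpLower (c 0 ^ 2) [c 0 * c 1, c 0 * c 2, c 0 * c 3] q)
        q (q / (c 0 * c 1 * c 2 * c 3)))) ∧
    symSum (fun c : Fin 4 → ℂ =>
        qPochInf ((c 0 ^ 2)⁻¹) q /
          qPochInfs [c 0 * c 1, c 0 * c 2, c 0 * c 3, c 1 / c 0, c 2 / c 0, c 3 / c 0] q *
        vwpW (c 0 ^ 2) [c 0 * c 1, c 0 * c 2, c 0 * c 3] q (q / (c 0 * c 1 * c 2 * c 3))) a =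
      qPochInf (a 0 * a 1 * a 2 * a 3) q /
          qPochInfs [a 0 * a 1, a 0 * a 2, a 0 * a 3, a 1 * a 2, a 1 * a 3, a 2 * a 3] q *
        symSum (fun c : Fin 4 → ℂ =>
          modThetas [(c 0 ^ 2)⁻¹, c 1 * c 2, c 1 * c 3, c 2 * c 3] q /
            modThetas [c 0 * c 1 * c 2 * c 3, c 1 / c 0, c 2 / c 0, c 3 / c 0] q) a ∧
    qPochInf (a 0 * a 1 * a 2 * a 3) q /
          qPochInfs [a 0 * a 1, a 0 * a 2, a 0 * a 3, a 1 * a 2, a 1 * a 3, a 2 * a 3] q *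
        symSum (fun c : Fin 4 → ℂ =>
          modThetas [(c 0 ^ 2)⁻¹, c 1 * c 2, c 1 * c 3, c 2 * c 3] q /
            modThetas [c 0 * c 1 * c 2 * c 3, c 1 / c 0, c 2 / c 0, c 3 / c 0] q) a =
      2 * qPochInf (a 0 * a 1 * a 2 * a 3) q /
          qPochInfs [a 0 * a 1, a 0 * a 2, a 0 * a 3, a 1 * a 2, a 1 * a 3, a 2 * a 3] q := by
  -- No power of `q` has norm strictly between `‖q‖` and 1.
  have hall : ∀ m : ℤ, a 0 * a 1 * a 2 * a 3 ≠ q ^ m := by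
    intro m hm
    rw [hm, norm_zpow] at hlow hup
    have hq' : 0 < ‖q‖ := norm_pos_iff.2 hq0
    have h1 : 0 < m := by
      by_contra! h
      exact hup.not_ge (one_le_zpow_of_nonpos₀ hq' hq1.le h)
    have h2 : m < 1 := (zpow_lt_zpow_iff_right_of_lt_one₀ hq' hq1).1 (by simpa using hlow)
    omega
  have hperm (σ : Equiv.Perm (Fin 4)) : (a ∘ σ) 0 * (a ∘ σ) 1 * (a ∘ σ) 2 * (a ∘ σ) 3 =
      a 0 * a 1 * a 2 * a 3 := by
    rw [← Fin.prod_univ_four, ← Fin.prod_univ_four]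
    exact Equiv.prod_comp σ a
  have main (σ : Equiv.Perm (Fin 4)) := by
    have np (i j : Fin 4) (hij : i ≠ j) := hprod (σ i) (σ j) (σ.injective.ne hij)
    have nq (i j : Fin 4) (hij : i ≠ j) := hquot (σ i) (σ j) (σ.injective.ne hij)
    exact vwpW_eq_modThetas hq0 hq1 (ha (σ 0)) (ha (σ 1)) (ha (σ 2)) (ha (σ 3)) (hsq (σ 0))
      (np 0 1 (by decide)) (np 0 2 (by decide)) (np 0 3 (by decide)) (np 1 2 (by decide))
      (np 1 3 (by decide)) (np 2 3 (by decide)) (nq 0 1 (by decide)) (nq 0 2 (by decide))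
      (nq 0 3 (by decide)) (hlow.trans_eq (congrArg norm (hperm σ).symm))
      (fun m => (hperm σ).trans_ne (hall m))
  refine ⟨?_, ?_, ?_⟩
  · rintro k c rfl
    exact (main (Equiv.swap 0 k)).1
  -- The prefactor is invariant because a swap only permutes the six pair products.
  · have hQ (k : Fin 4) (c : Fin 4 → ℂ) (hc : c = a ∘ Equiv.swap 0 k) :
        qPochInfs [c 0 * c 1, c 0 * c 2, c 0 * c 3, c 1 * c 2, c 1 * c 3, c 2 * c 3] q =
        qPochInfs [a 0 * a 1, a 0 * a 2, a 0 * a 3, a 1 * a 2, a 1 * a 3, a 2 * a 3] q := by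
      subst hc
      simp only [qPochInfs, List.map_cons, List.map_nil, List.prod_cons, List.prod_nil, mul_one,
        Function.comp_apply]
      fin_cases k
      · rfl
      · change qPochInf (a 1 * a 0) q * (qPochInf (a 1 * a 2) q * (qPochInf (a 1 * a 3) q *
          (qPochInf (a 0 * a 2) q * (qPochInf (a 0 * a 3) q * qPochInf (a 2 * a 3) q)))) = _
        rw [mul_comm (a 1) (a 0)]
        ring
      · change qPochInf (a 2 * a 1) q * (qPochInf (a 2 * a 0) q * (qPochInf (a 2 * a 3) q *
          (qPochInf (a 1 * a 0) q * (qPochInf (a 1 * a 3) q * qPochInf (a 0 * a 3) q)))) = _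
        rw [mul_comm (a 1) (a 0), mul_comm (a 2) (a 0), mul_comm (a 2) (a 1)]
        ring
      · change qPochInf (a 3 * a 1) q * (qPochInf (a 3 * a 2) q * (qPochInf (a 3 * a 0) q *
          (qPochInf (a 1 * a 2) q * (qPochInf (a 1 * a 0) q * qPochInf (a 2 * a 0) q)))) = _
        rw [mul_comm (a 3) (a 0), mul_comm (a 3) (a 1), mul_comm (a 3) (a 2),
          mul_comm (a 1) (a 0), mul_comm (a 2) (a 0)]
        ring
    rw [symSum, symSum, Finset.mul_sum]
    refine Finset.sum_congr rfl fun k _ => ?_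
    refine (main (Equiv.swap 0 k)).2.trans ?_
    have h1 := hQ k _ rfl
    have h2 := hperm (Equiv.swap 0 k)
    simp only [Function.comp_apply] at h1 h2 ⊢
    rw [h1, h2]
  · have hS := theta_identity hq0 hq1 (ha 0) (ha 1) (ha 2) (ha 3) (hsq 1) (hsq 2)
      (hprod 1 2 (by decide)) (hprod 1 3 (by decide)) (hprod 2 3 (by decide))
      (hquot 0 1 (by decide)) (hquot 0 2 (by decide)) (hquot 0 3 (by decide))
      (hquot 1 2 (by decide)) (hquot 1 3 (by decide)) (hquot 2 3 (by decide)) hall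
    rw [mul_comm, ← mul_div_assoc]
    congr 2
    rw [symSum_fin_four, ← hS]
    simp only [hperm]
    refine congrArg₂ (· + ·) (congrArg₂ (· + ·) (congrArg₂ (· + ·) rfl rfl) ?_) ?_
    · change modThetas [(a 2 ^ 2)⁻¹, a 1 * a 0, a 1 * a 3, a 0 * a 3] q /
        modThetas [_, a 1 / a 2, a 0 / a 2, a 3 / a 2] q = _
      simp only [modThetas, List.map_cons, List.map_nil, List.prod_cons, List.prod_nil]
      rw [mul_comm (a 1) (a 0)]
      ring
    · change modThetas [(a 3 ^ 2)⁻¹, a 1 * a 2, a 1 * a 0, a 2 * a 0] q /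
        modThetas [_, a 1 / a 3, a 2 / a 3, a 0 / a 3] q = _
      simp only [modThetas, List.map_cons, List.map_nil, List.prod_cons, List.prod_nil]
      rw [mul_comm (a 1) (a 0), mul_comm (a 2) (a 0)]
      ring
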